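/- Let $n\ge 1$ and write points of $\mathbb R^{n+1}$ as $X=(x,t)$ with $x\in\mathbb R^n$, $t\in\mathbb R$. Let $|\cdot|$ denote Lebesgue measure on $\mathbb R^{n+1}$, let $F(x,t)=(4\pi t)^{-n/2}e^{-|x|^2/(4t)}$ for $t>0$ and $F(x,t)=0$ for $t\le 0$, and for $Y=(y,s)$ and $r>0$ let $C_r(Y)=\{(x,t): |x-y|<r,\ s-r^2<t<s\}$. For a set $K\subset\mathbb R^{n+1}$ let $$\mathrm{cap}(K)=\sup\{\mu(\mathbb R^{n+1}) : \mu \text{ a nonnegative Radon measure carried by } K \text{ (i.e. } \mu(K^c)=0),\ F*\mu\le 1 \text{ on } \mathbb R^{n+1}\}.$$ Let $Q\subset\mathbb R^{n+1}$ be open. Its parabolic boundary $\partial_pQ$ is the set of all $(x_0,t_0)\in\partial Q$ for which there are $\delta>0$ and a continuous function $x:[t_0,t_0+\delta)\to\mathbb R^n$ with $x(t_0)=x_0$ and $(x(t),t)\in Q$ for all $t\in(t_0,t_0+\delta)$. $Q$ satisfies condition (A) if there is $\theta_0\in(0,1)$ such that $|C_r(Y_0)\setminus Q|>\theta_0|C_r(Y_0)|$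 for all $Y_0\in\partial_pQ$ and $r>0$. $Q$ satisfies condition (B) if there is $\theta_1\in(0,1)$ such that for every $Y_0\in\partial_pQ$ and every $\lambda>1$ there is an integer $k_0\ge 1$ with $$\bigl|\{Y:\lambda^{k_0(k+1)}\ge F(Y_0-Y)\ge\lambda^{k_0k}\}\setminus Q\bigr|>\theta_1\bigl|\{Y:\lambda^{k_0(k+1)}\ge F(Y_0-Y)\ge\lambda^{k_0k}\}\bigr|\quad\text{for all integers } k\ge 1.$$ A point $X_0\in\partial_pQ$ is called (Wiener-)regular for the heat equation if it satisfies the Evans–Gariepy form of Wiener's criterion: for every $\lambda>1$, $$\sum_{k=1}^{\infty}\lambda^k\,\mathrm{cap}\bigl(Q^c\cap\{X:\lambda^{k+1}\ge F(X_0-X)\ge\lambda^k\}\bigr)=\infty .$$ **Theorem.** If $Q$ satisfies condition (B), then every point of $\partial_pQ$ is regular. Moreover, if $Q$ satisfies condition (A), then every point of $\partial_pQ$ is regular. -/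

import Mathlib

open MeasureTheory Set
open scoped ENNReal

noncomputable section

namespace ThermalWiener

/-- Space-time `ℝⁿ⁺¹ = ℝⁿ × ℝ`; a point is `X = (x, t)`, with the Euclidean norm on `ℝⁿ`.
Its `volume` is the `(n+1)`-dimensional Lebesgue measure. -/
abbrev SpaceTime (n : ℕ) : Type := EuclideanSpace ℝ (Fin n) × ℝ

variable {n : ℕ}

/-- The fundamental solution of the heat equation:
`F(x,t) = (4πt)^(-n/2) exp(-|x|²/(4t))` for `t > 0` and `F(x,t) = 0` for `t ≤ 0`. -/
def heatKernel (X : SpaceTime n) : ℝ :=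
  if 0 < X.2 then
    (4 * Real.pi * X.2) ^ (-(n : ℝ) / 2) * Real.exp (-(‖X.1‖ ^ 2 / (4 * X.2)))
  else 0

/-- The standard parabolic cylinder `C_r(Y) = B_r(y) × (s - r², s)`, where `Y = (y, s)`. -/
def parabolicCylinder (Y : SpaceTime n) (r : ℝ) : Set (SpaceTime n) :=
  Metric.ball Y.1 r ×ˢ Ioo (Y.2 - r ^ 2) Y.2

/-- The parabolic boundary `∂_p Q`: the points `(x₀, t₀)` of the topological boundary of `Q` for
which there are `δ > 0` and a continuous curve `x : [t₀, t₀ + δ) → ℝⁿ` with `x(t₀) = x₀` and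
`(x(t), t) ∈ Q` for all `t ∈ (t₀, t₀ + δ)`. -/
def parabolicBoundary (Q : Set (SpaceTime n)) : Set (SpaceTime n) :=
  {X₀ | X₀ ∈ frontier Q ∧ ∃ δ : ℝ, 0 < δ ∧ ∃ x : ℝ → EuclideanSpace ℝ (Fin n),
    ContinuousOn x (Ico X₀.2 (X₀.2 + δ)) ∧ x X₀.2 = X₀.1 ∧
      ∀ t ∈ Ioo X₀.2 (X₀.2 + δ), (x t, t) ∈ Q}

/-- The heat shell `{Y : b ≥ F(Y₀ - Y) ≥ a}`. -/
def heatShell (Y₀ : SpaceTime n) (a b : ℝ) : Set (SpaceTime n) :=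
  {Y | a ≤ heatKernel (Y₀ - Y) ∧ heatKernel (Y₀ - Y) ≤ b}

/-- Condition (A), the exterior measure condition. -/
def ConditionA (Q : Set (SpaceTime n)) : Prop :=
  ∃ θ₀ ∈ Ioo (0 : ℝ) 1, ∀ Y₀ ∈ parabolicBoundary Q, ∀ r : ℝ, 0 < r →
    ENNReal.ofReal θ₀ * volume (parabolicCylinder Y₀ r) < volume (parabolicCylinder Y₀ r \ Q)

/-- Condition (B), the exterior measure condition on heat shells. Here `k₀` and `k` range over the
positive integers; `θ₁` depends on `Q` only, while `k₀` may depend on `Y₀` and `l`. -/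
def ConditionB (Q : Set (SpaceTime n)) : Prop :=
  ∃ θ₁ ∈ Ioo (0 : ℝ) 1, ∀ Y₀ ∈ parabolicBoundary Q, ∀ l : ℝ, 1 < l →
    ∃ k₀ : ℕ, 1 ≤ k₀ ∧ ∀ k : ℕ, 1 ≤ k →
      ENNReal.ofReal θ₁ * volume (heatShell Y₀ ((l ^ k₀) ^ k) ((l ^ k₀) ^ (k + 1))) <
        volume (heatShell Y₀ ((l ^ k₀) ^ k) ((l ^ k₀) ^ (k + 1)) \ Q)

/-- The thermal potential `(F * μ)(X) = ∫ F(X - Y) dμ(Y) ∈ [0, ∞]`. -/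
def heatPotential (μ : Measure (SpaceTime n)) (X : SpaceTime n) : ℝ≥0∞ :=
  ∫⁻ Y, ENNReal.ofReal (heatKernel (X - Y)) ∂μ

/-- The thermal capacity `cap(K) = sup {μ(ℝⁿ⁺¹)}`, over the nonnegative Radon measures `μ` carried
by `K` with `F * μ ≤ 1` everywhere. Radon measures on `ℝⁿ⁺¹` are the locally finite Borel measures.
For closed `K`, `μ(Kᶜ) = 0` says that the support of `μ` lies in `K`. For Borel `K`, the value is
the supremum of the capacities of the compact subsets of `K`, because restricting `μ` to a compact
subset decreases `F * μ`, and `μ` is inner regular. -/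
def thermalCapacity (K : Set (SpaceTime n)) : ℝ≥0∞ :=
  sSup {m | ∃ μ : Measure (SpaceTime n), IsLocallyFiniteMeasure μ ∧ μ Kᶜ = 0 ∧
    (∀ X, heatPotential μ X ≤ 1) ∧ m = μ univ}

/-- `X₀` is regular for `Q`, in the sense of Wiener's criterion for the heat equation: for every
`l > 1`, the series `∑_{k ≥ 1} l^k cap(Qᶜ ∩ {l^(k+1) ≥ F(X₀ - X) ≥ l^k})` diverges. The summation
index `j` below is `k - 1`. -/
def WienerRegular (Q : Set (SpaceTime n)) (X₀ : SpaceTime n) : Prop :=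
  ∀ l : ℝ, 1 < l →
    ∑' j : ℕ, ENNReal.ofReal (l ^ (j + 1)) *
      thermalCapacity (Qᶜ ∩ heatShell X₀ (l ^ (j + 1)) (l ^ (j + 2))) = ∞

end ThermalWiener

end

/-! Everything rests on the parabolic scaling `F (r x, r² t) = r⁻ⁿ F (x, t)`. A set contained in a
time slab of height `T` has capacity at least its volume divided by `T`, because Lebesgue measure on
the slab has potential at most `T`. The shell where `F` is of order `r⁻ⁿ` has height of order `r²`
and volume of order `r ^ (n + 2)`, so if `Qᶜ` fills a fixed fraction of it, the terms of the Wiener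
series with `l ^ k` of order `r⁻ⁿ` add up, up to a constant, to at least `r⁻ⁿ · r ^ (n + 2) / r²`,
which is `1`. This happens at infinitely many scales, so the series diverges. Shells and cylinders
enter only as two examples of a family of dilates of one set `E` of finite volume lying in the past;
up to a small part of its volume, such an `E` lies in a single shell. -/

namespace ThermalWiener

open Filter
open scoped Topology

variable {n : ℕ}

section HeatKernel

lemma heatKernel_of_pos {X : SpaceTime n} (h : 0 < X.2) :
    heatKernel X = (4 * Real.pi * X.2) ^ (-(n : ℝ) / 2) *
      Real.exp (-(‖X.1‖ ^ 2 / (4 * X.2))) := if_pos h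

lemma heatKernel_pos_iff {X : SpaceTime n} : 0 < heatKernel X ↔ 0 < X.2 := by
  refine ⟨fun h => ?_, fun h => ?_⟩
  · by_contra hX
    exact h.ne' (if_neg hX)
  · rw [heatKernel_of_pos h]
    positivity

lemma heatKernel_le_rpow {X : SpaceTime n} (h : 0 < X.2) :
    heatKernel X ≤ (4 * Real.pi * X.2) ^ (-(n : ℝ) / 2) := by
  rw [heatKernel_of_pos h]
  exact mul_le_of_le_one_right (by positivity)
    (Real.exp_le_one_iff.2 (neg_nonpos.2 (by positivity)))

@[fun_prop]
lemma measurable_heatKernel : Measurable (heatKernel : SpaceTime n → ℝ) := by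
  unfold heatKernel
  refine Measurable.ite (measurableSet_lt measurable_const measurable_snd) ?_ measurable_const
  fun_prop

lemma measurableSet_heatShell (Y : SpaceTime n) (a b : ℝ) : MeasurableSet (heatShell Y a b) :=
  measurableSet_Icc.preimage (f := fun X => heatKernel (Y - X)) (by fun_prop)

lemma heatShell_subset_heatShell (X : SpaceTime n) {a a' b b' : ℝ} (ha : a' ≤ a) (hb : b ≤ b') :
    heatShell X a b ⊆ heatShell X a' b' :=
  fun _ hY => ⟨ha.trans hY.1, hY.2.trans hb⟩

lemma heatShell_subset_biUnion (X : SpaceTime n) (a : ℕ → ℝ) (m : ℕ) :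
    heatShell X (a 0) (a (m + 1)) ⊆
      ⋃ i ∈ Finset.range (m + 1), heatShell X (a i) (a (i + 1)) := by
  induction m with
  | zero => simp
  | succ m ih =>
    rw [Finset.range_add_one, Finset.set_biUnion_insert]
    rintro Y ⟨hlow, hup⟩
    rcases le_total (a (m + 1)) (heatKernel (X - Y)) with h | h
    · exact Or.inl ⟨h, hup⟩
    · exact Or.inr (ih ⟨hlow, h⟩)

lemma integrable_exp_neg_mul_sq_norm {V : Type*} [NormedAddCommGroup V] [InnerProductSpace ℝ V]
    [FiniteDimensional ℝ V] [MeasurableSpace V] [BorelSpace V] {b : ℝ} (hb : 0 < b) :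
    Integrable fun x : V => Real.exp (-b * ‖x‖ ^ 2) := by
  refine .of_integral_ne_zero ?_
  rw [GaussianFourier.integral_rexp_neg_mul_sq_norm hb]
  positivity

lemma lintegral_heatKernel {t : ℝ} (ht : 0 < t) :
    ∫⁻ x : EuclideanSpace ℝ (Fin n), ENNReal.ofReal (heatKernel (x, t)) = 1 := by
  have hb : 0 < (4 * t)⁻¹ := by positivity
  have kernel_eq (x : EuclideanSpace ℝ (Fin n)) : heatKernel (x, t) =
      (4 * Real.pi * t) ^ (-(n : ℝ) / 2) * Real.exp (-(4 * t)⁻¹ * ‖x‖ ^ 2) := by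
    rw [heatKernel_of_pos (X := (x, t)) ht, neg_mul, ← div_eq_inv_mul]
  simp_rw [kernel_eq]
  rw [← ofReal_integral_eq_lintegral_ofReal ((integrable_exp_neg_mul_sq_norm hb).const_mul _)
      (ae_of_all _ fun x => by positivity), integral_const_mul,
    GaussianFourier.integral_rexp_neg_mul_sq_norm hb, finrank_euclideanSpace_fin,
    show Real.pi / (4 * t)⁻¹ = 4 * Real.pi * t by field_simp, ← Real.rpow_add (by positivity),
    neg_div, neg_add_cancel, Real.rpow_zero, ENNReal.ofReal_one]

lemma lintegral_heatKernel_le_one (t : ℝ) :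
    ∫⁻ x : EuclideanSpace ℝ (Fin n), ENNReal.ofReal (heatKernel (x, t)) ≤ 1 := by
  rcases lt_or_ge 0 t with ht | ht
  · exact (lintegral_heatKernel ht).le
  · simp [heatKernel, ht.not_gt]

end HeatKernel

section Capacity

lemma heatPotential_restrict_slab_le (I : Set ℝ) (X : SpaceTime n) :
    heatPotential (volume.restrict (univ ×ˢ I)) X ≤ volume I := by
  rw [heatPotential, Measure.volume_eq_prod, ← Measure.prod_restrict, Measure.restrict_univ,
    lintegral_prod_symm _ (by fun_prop)]
  calc _ ≤ ∫⁻ _ in I, 1 := lintegral_mono fun t =>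
        (lintegral_sub_left_eq_self
          (fun x => ENNReal.ofReal (heatKernel (x, X.2 - t))) X.1).trans_le
            (lintegral_heatKernel_le_one _)
    _ = volume I := by simp

lemma volume_div_le_thermalCapacity {K : Set (SpaceTime n)} (hK : NullMeasurableSet K) {I : Set ℝ}
    (hI : volume I ≠ 0) (hKI : K ⊆ univ ×ˢ I) :
    volume K / volume I ≤ thermalCapacity K := by
  have : IsLocallyFiniteMeasure ((volume I)⁻¹ • (volume : Measure (SpaceTime n)).restrict K) := by
    lift (volume I)⁻¹ to NNReal using ENNReal.inv_ne_top.2 hI with c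
    exact inferInstanceAs (IsLocallyFiniteMeasure (c • volume.restrict K))
  refine le_sSup ⟨(volume I)⁻¹ • volume.restrict K, this, ?_, fun X => ?_, ?_⟩
  · simp [Measure.restrict_apply₀' hK]
  · rw [heatPotential, lintegral_smul_measure, smul_eq_mul]
    calc _ ≤ (volume I)⁻¹ * volume I := by
          gcongr
          exact (lintegral_mono_set hKI).trans (heatPotential_restrict_slab_le I X)
      _ ≤ 1 := ENNReal.inv_mul_le_one _
  · rw [Measure.smul_apply, Measure.restrict_apply_univ, smul_eq_mul, ENNReal.div_eq_inv_mul]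

end Capacity

section Dilation

/-- The parabolic dilation `(y, s) ↦ (x₀ + r y, t₀ + r² s)`, which blows up the neighbourhood of
`X = (x₀, t₀)` at scale `r` to unit size when used as a preimage. -/
def parabolicDilation (X : SpaceTime n) (r : ℝ) (Y : SpaceTime n) : SpaceTime n :=
  X + (r • Y.1, r ^ 2 * Y.2)

lemma heatKernel_smul {r : ℝ} (hr : 0 < r) (X : SpaceTime n) :
    heatKernel (r • X.1, r ^ 2 * X.2) = heatKernel X / r ^ n := by
  rcases lt_or_ge 0 X.2 with ht | ht
  · have hprefactor : (4 * Real.pi * (r ^ 2 * X.2)) ^ (-(n : ℝ) / 2) =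
        (4 * Real.pi * X.2) ^ (-(n : ℝ) / 2) / r ^ n := by
      have hpow : (r ^ 2) ^ (-(n : ℝ) / 2) = (r ^ n)⁻¹ := by
        rw [← Real.rpow_natCast, ← Real.rpow_mul hr.le, ← Real.rpow_natCast, ← Real.rpow_neg hr.le]
        congr 1
        push_cast
        ring
      rw [mul_left_comm, Real.mul_rpow (by positivity) (by positivity), hpow, inv_mul_eq_div]
    have hexponent : ‖r • X.1‖ ^ 2 / (4 * (r ^ 2 * X.2)) = ‖X.1‖ ^ 2 / (4 * X.2) := by
      rw [norm_smul, Real.norm_of_nonneg hr.le]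
      field_simp
    rw [heatKernel_of_pos ht, heatKernel_of_pos (by positivity), hprefactor, hexponent,
      div_mul_eq_mul_div]
  · simp [heatKernel, ht.not_gt, (mul_nonpos_of_nonneg_of_nonpos (sq_nonneg r) ht).not_gt]

lemma heatKernel_sub_parabolicDilation {r : ℝ} (hr : 0 < r) (X Y : SpaceTime n) :
    heatKernel (X - parabolicDilation X r Y) = heatKernel (0 - Y) / r ^ n := by
  rw [← heatKernel_smul hr]
  congr 1
  ext1 <;> simp [parabolicDilation]

lemma parabolicDilation_preimage_heatShell {r : ℝ} (hr : 0 < r) (X : SpaceTime n) (a b : ℝ) :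
    parabolicDilation X r ⁻¹' heatShell X (a / r ^ n) (b / r ^ n) = heatShell 0 a b := by
  have hrn : 0 < r ^ n := by positivity
  ext Y
  simp only [heatShell, mem_preimage, mem_ofPred_eq, heatKernel_sub_parabolicDilation hr,
    div_le_div_iff_of_pos_right hrn]

lemma parabolicDilation_preimage_parabolicCylinder {r : ℝ} (hr : 0 < r) (X : SpaceTime n) :
    parabolicDilation X r ⁻¹' parabolicCylinder X r = parabolicCylinder 0 1 := by
  have hr2 : 0 < r ^ 2 := by positivity
  ext Y
  have hspace : ‖r • Y.1‖ < r ↔ ‖Y.1‖ < 1 := by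
    rw [norm_smul, Real.norm_of_nonneg hr.le, mul_lt_iff_lt_one_right hr]
  have hpast : r ^ 2 * Y.2 < 0 ↔ Y.2 < 0 := smul_neg_iff_of_pos_left hr2
  have htime : -r ^ 2 < r ^ 2 * Y.2 ↔ -1 < Y.2 := by
    rw [← mul_neg_one, mul_lt_mul_iff_right₀ hr2]
  simp [parabolicDilation, parabolicCylinder, hspace, sub_eq_add_neg, htime, hpast]

lemma volume_parabolicDilation_preimage {r : ℝ} (hr : 0 < r) (X : SpaceTime n)
    (S : Set (SpaceTime n)) :
    volume (parabolicDilation X r ⁻¹' S) = ENNReal.ofReal (r ^ (n + 2))⁻¹ * volume S := by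
  let L : SpaceTime n →ₗ[ℝ] SpaceTime n :=
    (r • LinearMap.id).prodMap (r ^ 2 • LinearMap.id)
  have : (volume : Measure (SpaceTime n)).IsAddHaarMeasure :=
    Measure.prod.instIsAddHaarMeasure _ _
  have hdet : LinearMap.det L = r ^ (n + 2) := by
    simp [L, LinearMap.det_prodMap, pow_add]
  have hpos : 0 < r ^ (n + 2) := by positivity
  have hpreimage : parabolicDilation X r ⁻¹' S = L ⁻¹' ((X + ·) ⁻¹' S) := rfl
  rw [hpreimage, Measure.addHaar_preimage_linearMap _ (hdet ▸ hpos.ne'), hdet,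
    measure_preimage_add, abs_of_pos (inv_pos.2 hpos)]

lemma volume_heatShell_diff {r : ℝ} (hr : 0 < r) (X : SpaceTime n) (a b : ℝ)
    (Q : Set (SpaceTime n)) :
    volume (heatShell X (a / r ^ n) (b / r ^ n) \ Q) =
      ENNReal.ofReal (r ^ (n + 2)) * volume (heatShell 0 a b \ parabolicDilation X r ⁻¹' Q) := by
  rw [← parabolicDilation_preimage_heatShell hr X, ← preimage_sdiff,
    volume_parabolicDilation_preimage hr, ← mul_assoc, ← ENNReal.ofReal_mul (by positivity),
    mul_inv_cancel₀ (by positivity), ENNReal.ofReal_one, one_mul]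

lemma exists_snd_le_of_le_heatKernel (hn : n ≠ 0) {κ : ℝ} (hκ : 0 < κ) :
    ∃ T : ℝ, 0 < T ∧ ∀ X : SpaceTime n, κ ≤ heatKernel X → X.2 ≤ T := by
  have hdecay : Tendsto (fun t : ℝ => (4 * Real.pi * t) ^ (-(n : ℝ) / 2)) atTop (𝓝 0) := by
    rw [neg_div]
    exact (tendsto_rpow_neg_atTop (by positivity)).comp
      (tendsto_id.const_mul_atTop (by positivity))
  obtain ⟨T, hT⟩ := eventually_atTop.1 (hdecay.eventually_lt_const hκ)
  refine ⟨max T 1, by positivity, fun X hX => ?_⟩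
  by_contra! hlt
  have ht : 0 < X.2 := heatKernel_pos_iff.1 (hκ.trans_le hX)
  exact (hX.trans (heatKernel_le_rpow ht)).not_gt (hT X.2 (le_of_max_le_left hlt.le))

lemma snd_le_sq_mul_of_div_le_heatKernel {κ T : ℝ}
    (hT : ∀ X : SpaceTime n, κ ≤ heatKernel X → X.2 ≤ T) {r : ℝ} (hr : 0 < r) {X : SpaceTime n}
    (hX : κ / r ^ n ≤ heatKernel X) : X.2 ≤ r ^ 2 * T := by
  have h := hT (r⁻¹ • X.1, r⁻¹ ^ 2 * X.2) <| by
    rwa [heatKernel_smul (inv_pos.2 hr), inv_pow, div_inv_eq_mul, ← div_le_iff₀ (by positivity)]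
  rwa [inv_pow, inv_mul_le_iff₀ (by positivity)] at h

end Dilation

section WienerSeries

/-- The `q`-th term of the Wiener series of `Q` at `X` with ratio `l`. It is indexed by all `q : ℕ`,
so that the series in `WienerRegular` is `∑' j, wienerTerm Q X l (j + 1)`. -/
noncomputable def wienerTerm (Q : Set (SpaceTime n)) (X : SpaceTime n) (l : ℝ) (q : ℕ) : ℝ≥0∞ :=
  ENNReal.ofReal (l ^ q) * thermalCapacity (Qᶜ ∩ heatShell X (l ^ q) (l ^ (q + 1)))

lemma tsum_add_eq_top_of_frequently_le_sum {f : ℕ → ℝ≥0∞} {c : ℝ≥0∞} (hc : c ≠ 0) (m k : ℕ)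
    (h : ∃ᶠ p in atTop, c ≤ ∑ i ∈ Finset.range m, f (p + i)) : ∑' j, f (j + k) = ∞ := by
  by_contra hsum
  have hf : Tendsto f atTop (𝓝 0) :=
    (tendsto_add_atTop_iff_nat k).1 (ENNReal.tendsto_atTop_zero_of_tsum_ne_top hsum)
  have hblock : Tendsto (fun p => ∑ i ∈ Finset.range m, f (p + i)) atTop (𝓝 0) := by
    simpa using tendsto_finsetSum (Finset.range m) fun i _ => (tendsto_add_atTop_iff_nat i).2 hf
  exact h ((hblock.eventually_lt_const (pos_iff_ne_zero.2 hc)).mono fun _ => not_le.2)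

lemma volume_heatShell_diff_div_le_wienerTerm {Q : Set (SpaceTime n)} (hQ : NullMeasurableSet Q)
    (X : SpaceTime n) {l T a : ℝ} {q : ℕ} (hl : 0 < l) (hT : 0 < T)
    (hslab : ∀ Z : SpaceTime n, a ≤ heatKernel Z → Z.2 ≤ T) (ha : a ≤ l ^ q) :
    ENNReal.ofReal a * (volume (heatShell X (l ^ q) (l ^ (q + 1)) \ Q) / ENNReal.ofReal T) ≤
      wienerTerm Q X l q := by
  have hsubset : Qᶜ ∩ heatShell X (l ^ q) (l ^ (q + 1)) ⊆ univ ×ˢ Icc (X.2 - T) X.2 := by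
    rintro Y ⟨-, hY, -⟩
    have hpos : 0 < X.2 - Y.2 := heatKernel_pos_iff.1 ((pow_pos hl q).trans_le hY)
    have hle : X.2 - Y.2 ≤ T := hslab (X - Y) (ha.trans hY)
    exact ⟨mem_univ _, by linarith, by linarith⟩
  have hvol : volume (Icc (X.2 - T) X.2) = ENNReal.ofReal T := by
    rw [Real.volume_Icc, sub_sub_cancel]
  have hcap := volume_div_le_thermalCapacity
    (hQ.compl.inter (measurableSet_heatShell _ _ _).nullMeasurableSet)
    (hvol ▸ (ENNReal.ofReal_pos.2 hT).ne') hsubset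
  rw [hvol, inter_comm, ← sdiff_eq] at hcap
  rw [wienerTerm, inter_comm, ← sdiff_eq]
  gcongr

lemma volume_heatShell_diff_div_le_sum_wienerTerm {Q : Set (SpaceTime n)}
    (hQ : NullMeasurableSet Q) (X : SpaceTime n) {l T a : ℝ} {p : ℕ} (hl : 1 < l) (hT : 0 < T)
    (hslab : ∀ Z : SpaceTime n, a ≤ heatKernel Z → Z.2 ≤ T) (ha : a ≤ l ^ p) (m : ℕ) :
    ENNReal.ofReal a * (volume (heatShell X (l ^ p) (l ^ (p + (m + 1))) \ Q) / ENNReal.ofReal T) ≤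
      ∑ i ∈ Finset.range (m + 1), wienerTerm Q X l (p + i) := by
  have hcover : volume (heatShell X (l ^ p) (l ^ (p + (m + 1))) \ Q) ≤
      ∑ i ∈ Finset.range (m + 1), volume (heatShell X (l ^ (p + i)) (l ^ (p + i + 1)) \ Q) := by
    refine (measure_mono ?_).trans (measure_biUnion_finset_le _ _)
    simp_rw [← iUnion_sdiff]
    exact sdiff_subset_sdiff_left (heatShell_subset_biUnion X (fun i => l ^ (p + i)) m)
  calc _ ≤ ∑ i ∈ Finset.range (m + 1), ENNReal.ofReal a *
        (volume (heatShell X (l ^ (p + i)) (l ^ (p + i + 1)) \ Q) / ENNReal.ofReal T) := by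
        simp_rw [← Finset.mul_sum, div_eq_mul_inv, ← Finset.sum_mul]
        gcongr
    _ ≤ _ := Finset.sum_le_sum fun i _ =>
        volume_heatShell_diff_div_le_wienerTerm hQ X (one_pos.trans hl) hT hslab
          (ha.trans (pow_le_pow_right₀ hl.le (Nat.le_add_right p i)))

/-- One scale `r`: the powers of `r` coming from the size `r⁻ⁿ` of the kernel, the volume and the
height of the shell cancel. -/
lemma mul_volume_blowup_le_sum_wienerTerm {Q : Set (SpaceTime n)} (hQ : NullMeasurableSet Q)
    (X : SpaceTime n) {l : ℝ} (hl : 1 < l) {d p : ℕ} {T r : ℝ} (hT : 0 < T)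
    (hslab : ∀ Z : SpaceTime n, (l ^ (d + 1))⁻¹ ≤ heatKernel Z → Z.2 ≤ T) (hr : 0 < r)
    (hp : l ^ p ≤ (l ^ d * r ^ n)⁻¹) (hp' : (l ^ d * r ^ n)⁻¹ < l ^ (p + 1)) :
    ENNReal.ofReal ((l ^ (d + 1))⁻¹ / T) *
        volume (heatShell 0 (l ^ d)⁻¹ (l ^ d) \ parabolicDilation X r ⁻¹' Q) ≤
      ∑ i ∈ Finset.range (2 * d + 1), wienerTerm Q X l (p + i) := by
  have hl0 : 0 < l := one_pos.trans hl
  have hκ : (l ^ (d + 1))⁻¹ / r ^ n ≤ l ^ p := by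
    rw [mul_inv, pow_succ l p, ← div_lt_iff₀ hl0] at hp'
    exact (by rw [pow_succ]; field_simp : _ = _).trans_le hp'.le
  have hshell : heatShell X ((l ^ d)⁻¹ / r ^ n) (l ^ d / r ^ n) ⊆
      heatShell X (l ^ p) (l ^ (p + (2 * d + 1))) := by
    refine heatShell_subset_heatShell X (hp.trans_eq (by rw [mul_inv, div_eq_mul_inv])) ?_
    calc l ^ d / r ^ n = (l ^ d * r ^ n)⁻¹ * l ^ (2 * d) := by rw [two_mul, pow_add]; field_simp
      _ ≤ l ^ (p + 1) * l ^ (2 * d) := by gcongr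
      _ = l ^ (p + (2 * d + 1)) := by ring
  refine le_trans ?_ (volume_heatShell_diff_div_le_sum_wienerTerm hQ X hl (by positivity)
    (fun _ => snd_le_sq_mul_of_div_le_heatKernel hslab hr) hκ (2 * d))
  calc _ = ENNReal.ofReal ((l ^ (d + 1))⁻¹ / r ^ n) *
        (volume (heatShell X ((l ^ d)⁻¹ / r ^ n) (l ^ d / r ^ n) \ Q) /
          ENNReal.ofReal (r ^ 2 * T)) := by
        rw [volume_heatShell_diff hr, div_eq_mul_inv _ (ENNReal.ofReal _),
          ← ENNReal.ofReal_inv_of_pos (by positivity), mul_right_comm, ← mul_assoc,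
          ← ENNReal.ofReal_mul (by positivity), ← ENNReal.ofReal_mul (by positivity)]
        congr 2
        field_simp
        ring
    _ ≤ _ := by gcongr

end WienerSeries

section Density

lemma exists_volume_diff_heatShell_lt {E : Set (SpaceTime n)} (hE : MeasurableSet E)
    (hE_past : ∀ Y ∈ E, Y.2 < 0) (hE_fin : volume E ≠ ∞) {l : ℝ} (hl : 1 < l) {ε : ℝ≥0∞}
    (hε : ε ≠ 0) : ∃ d : ℕ, volume (E \ heatShell 0 (l ^ d)⁻¹ (l ^ d)) < ε := by
  have hinter : ⋂ d : ℕ, E \ heatShell 0 (l ^ d)⁻¹ (l ^ d) = ∅ := by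
    refine eq_empty_of_forall_notMem fun Y hY => ?_
    rw [mem_iInter] at hY
    have hpos : 0 < heatKernel (0 - Y) :=
      heatKernel_pos_iff.2 (by simpa using hE_past Y (hY 0).1)
    obtain ⟨d, hd⟩ := pow_unbounded_of_one_lt (max (heatKernel (0 - Y)) (heatKernel (0 - Y))⁻¹) hl
    exact (hY d).2 ⟨inv_le_of_inv_le₀ hpos ((le_max_right _ _).trans hd.le),
      (le_max_left _ _).trans hd.le⟩
  have hanti : Antitone fun d : ℕ => E \ heatShell 0 (l ^ d)⁻¹ (l ^ d) := fun d e hde =>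
    sdiff_subset_sdiff_right <| heatShell_subset_heatShell 0
      (inv_anti₀ (pow_pos (one_pos.trans hl) d) (pow_le_pow_right₀ hl.le hde))
      (pow_le_pow_right₀ hl.le hde)
  have htendsto := tendsto_measure_iInter_atTop (μ := volume)
    (fun d => (hE.diff (measurableSet_heatShell _ _ _)).nullMeasurableSet) hanti
    ⟨0, measure_ne_top_of_subset sdiff_subset hE_fin⟩
  rw [hinter, measure_empty] at htendsto
  exact (htendsto.eventually_lt_const (pos_iff_ne_zero.2 hε)).exists

lemma tendsto_inv_const_mul_pow_nhdsGT_zero (hn : n ≠ 0) {a : ℝ} (ha : 0 < a) :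
    Tendsto (fun r : ℝ => (a * r ^ n)⁻¹) (𝓝[>] 0) atTop := by
  refine tendsto_inv_nhdsGT_zero.comp (tendsto_nhdsWithin_iff.2 ⟨?_, ?_⟩)
  · have hcont : Continuous fun r : ℝ => a * r ^ n := by fun_prop
    simpa [hn] using (hcont.tendsto 0).mono_left nhdsWithin_le_nhds
  · filter_upwards [self_mem_nhdsWithin] with r hr
    exact mul_pos ha (pow_pos hr n)

theorem wienerRegular_of_frequently_le_volume_blowup (hn : n ≠ 0) {Q : Set (SpaceTime n)}
    (hQ : NullMeasurableSet Q) {X : SpaceTime n} {E : Set (SpaceTime n)} (hE : MeasurableSet E)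
    (hE_past : ∀ Y ∈ E, Y.2 < 0) (hE_fin : volume E ≠ ∞) {η : ℝ≥0∞} (hη : η ≠ 0)
    (h : ∃ᶠ r in 𝓝[>] (0 : ℝ), η ≤ volume (E \ parabolicDilation X r ⁻¹' Q)) :
    WienerRegular Q X := by
  intro l hl
  have hl0 : 0 < l := one_pos.trans hl
  have hη2 : η / 2 ≠ 0 := (ENNReal.half_pos hη).ne'
  obtain ⟨d, hd⟩ := exists_volume_diff_heatShell_lt hE hE_past hE_fin hl hη2
  obtain ⟨T, hT, hslab⟩ := exists_snd_le_of_le_heatKernel hn (inv_pos.2 (pow_pos hl0 (d + 1)))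
  have hc : ENNReal.ofReal ((l ^ (d + 1))⁻¹ / T) * (η / 2) ≠ 0 :=
    mul_ne_zero (ENNReal.ofReal_pos.2 (by positivity)).ne' hη2
  refine tsum_add_eq_top_of_frequently_le_sum (f := wienerTerm Q X l) hc (2 * d + 1) 1 ?_
  refine frequently_atTop.2 fun N => ?_
  have hsmall := (tendsto_inv_const_mul_pow_nhdsGT_zero hn (pow_pos hl0 d)).eventually_ge_atTop
    (l ^ N)
  obtain ⟨r, hvol, hNr, hr⟩ := (h.and_eventually (hsmall.and self_mem_nhdsWithin)).exists
  obtain ⟨p, hp, hp'⟩ := exists_nat_pow_near ((one_le_pow₀ hl.le).trans hNr) hl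
  have hNp : N ≤ p := Nat.lt_succ_iff.1 ((pow_lt_pow_iff_right₀ hl).1 (hNr.trans_lt hp'))
  refine ⟨p, hNp, le_trans ?_ (mul_volume_blowup_le_sum_wienerTerm hQ X hl hT hslab hr hp hp')⟩
  gcongr
  have hsplit : E \ parabolicDilation X r ⁻¹' Q ⊆
      (heatShell 0 (l ^ d)⁻¹ (l ^ d) \ parabolicDilation X r ⁻¹' Q) ∪
        E \ heatShell 0 (l ^ d)⁻¹ (l ^ d) := by
    rintro Y ⟨hYE, hYQ⟩
    by_cases hY : Y ∈ heatShell 0 (l ^ d)⁻¹ (l ^ d)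
    exacts [Or.inl ⟨hY, hYQ⟩, Or.inr ⟨hYE, hY⟩]
  by_contra! hlt
  have hlt_η := (ENNReal.add_lt_add hlt hd).trans_eq (ENNReal.add_halves η)
  exact hlt_η.not_ge (hvol.trans ((measure_mono hsplit).trans (measure_union_le _ _)))

theorem wienerRegular_of_frequently_lt_volume_diff (hn : n ≠ 0) {Q : Set (SpaceTime n)}
    (hQ : NullMeasurableSet Q) {X : SpaceTime n} {E : Set (SpaceTime n)} (hE : MeasurableSet E)
    (hE_past : ∀ Y ∈ E, Y.2 < 0) {S : ℝ → Set (SpaceTime n)}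
    (hS : ∀ r, 0 < r → parabolicDilation X r ⁻¹' S r = E) {θ : ℝ≥0∞} (hθ : θ ≠ 0)
    (h : ∃ᶠ r in 𝓝[>] (0 : ℝ), θ * volume (S r) < volume (S r \ Q)) :
    WienerRegular Q X := by
  have hblowup : ∃ᶠ r in 𝓝[>] (0 : ℝ), θ * volume E < volume (E \ parabolicDilation X r ⁻¹' Q) := by
    refine (h.and_eventually self_mem_nhdsWithin).mono fun r ⟨hlt, hr⟩ => ?_
    have hr0 : 0 < r := hr
    rw [← hS r hr0, ← preimage_sdiff, volume_parabolicDilation_preimage hr0,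
      volume_parabolicDilation_preimage hr0, mul_left_comm]
    exact ENNReal.mul_lt_mul_right (ENNReal.ofReal_pos.2 (by positivity)).ne'
      ENNReal.ofReal_ne_top hlt
  -- A single instance of the strict inequality already forces `0 < volume E < ∞`.
  obtain ⟨r, hr⟩ := hblowup.exists
  have hE_fin : volume E ≠ ∞ := fun htop => by simp [htop, ENNReal.mul_top hθ] at hr
  have hE_ne : volume E ≠ 0 := ((zero_le.trans_lt hr).trans_le (measure_mono sdiff_subset)).ne'
  exact wienerRegular_of_frequently_le_volume_blowup hn hQ hE hE_past hE_fin
    (mul_ne_zero hθ hE_ne) (hblowup.mono fun _ => le_of_lt)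

theorem wienerRegular_of_frequently_lt_volume_parabolicCylinder_diff (hn : n ≠ 0)
    {Q : Set (SpaceTime n)} (hQ : NullMeasurableSet Q) {X : SpaceTime n} {θ : ℝ≥0∞} (hθ : θ ≠ 0)
    (h : ∃ᶠ r in 𝓝[>] (0 : ℝ),
      θ * volume (parabolicCylinder X r) < volume (parabolicCylinder X r \ Q)) :
    WienerRegular Q X :=
  wienerRegular_of_frequently_lt_volume_diff hn hQ (measurableSet_ball.prod measurableSet_Ioo)
    (fun _ hY => hY.2.2) (fun _ hr => parabolicDilation_preimage_parabolicCylinder hr X) hθ h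

theorem wienerRegular_of_frequently_lt_volume_heatShell_diff (hn : n ≠ 0)
    {Q : Set (SpaceTime n)} (hQ : NullMeasurableSet Q) {X : SpaceTime n} {θ : ℝ≥0∞} (hθ : θ ≠ 0)
    {l : ℝ} (hl : 1 < l)
    (h : ∃ᶠ k : ℕ in atTop, θ * volume (heatShell X (l ^ k) (l ^ (k + 1))) <
      volume (heatShell X (l ^ k) (l ^ (k + 1)) \ Q)) :
    WienerRegular Q X := by
  set ρ : ℝ := l⁻¹ ^ (n : ℝ)⁻¹
  have hρ : 0 < ρ := by positivity
  have hρn : ρ ^ n = l⁻¹ := Real.rpow_inv_natCast_pow (by positivity) hn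
  have hρ1 : ρ < 1 := Real.rpow_lt_one (by positivity) (inv_lt_one_of_one_lt₀ hl) (by positivity)
  have hscales : Tendsto (fun k : ℕ => ρ ^ k) atTop (𝓝[>] 0) :=
    tendsto_nhdsWithin_iff.2 ⟨tendsto_pow_atTop_nhds_zero_of_lt_one hρ.le hρ1,
      .of_forall fun k => pow_pos hρ k⟩
  have hpow (k : ℕ) : (ρ ^ k) ^ n = (l ^ k)⁻¹ := by rw [pow_right_comm, hρn, inv_pow]
  refine wienerRegular_of_frequently_lt_volume_diff hn hQ (measurableSet_heatShell 0 1 l)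
    (fun Y hY => ?_) (fun r hr => parabolicDilation_preimage_heatShell hr X 1 l) hθ
    (hscales.frequently (h.mono fun k hk => ?_))
  · simpa using heatKernel_pos_iff.1 (one_pos.trans_le hY.1)
  · simpa only [hpow, div_inv_eq_mul, one_mul, ← pow_succ'] using hk

end Density

lemma ConditionB.exists_frequently {Q : Set (SpaceTime n)} (hB : ConditionB Q) {X : SpaceTime n}
    (hX : X ∈ parabolicBoundary Q) :
    ∃ θ : ℝ≥0∞, θ ≠ 0 ∧ ∃ l : ℝ, 1 < l ∧ ∃ᶠ k : ℕ in atTop,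
      θ * volume (heatShell X (l ^ k) (l ^ (k + 1))) <
        volume (heatShell X (l ^ k) (l ^ (k + 1)) \ Q) := by
  obtain ⟨θ, hθ, hB⟩ := hB
  obtain ⟨k₀, hk₀, h⟩ := hB X hX 2 one_lt_two
  exact ⟨_, (ENNReal.ofReal_pos.2 hθ.1).ne', 2 ^ k₀, one_lt_pow₀ one_lt_two (by lia),
    ((eventually_ge_atTop 1).mono h).frequently⟩

lemma ConditionA.exists_frequently {Q : Set (SpaceTime n)} (hA : ConditionA Q) {X : SpaceTime n}
    (hX : X ∈ parabolicBoundary Q) :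
    ∃ θ : ℝ≥0∞, θ ≠ 0 ∧ ∃ᶠ r in 𝓝[>] (0 : ℝ),
      θ * volume (parabolicCylinder X r) < volume (parabolicCylinder X r \ Q) := by
  obtain ⟨θ, hθ, hA⟩ := hA
  refine ⟨_, (ENNReal.ofReal_pos.2 hθ.1).ne', Eventually.frequently ?_⟩
  filter_upwards [self_mem_nhdsWithin] with r hr using hA X hX r hr

end ThermalWiener

open ThermalWiener Filter Topology in
theorem theoremA7_general {n : ℕ} (hn : n ≠ 0) {Q : Set (SpaceTime n)} (hQ : NullMeasurableSet Q)
    (X₀ : SpaceTime n) :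
    ((∃ θ : ℝ≥0∞, θ ≠ 0 ∧ ∃ l : ℝ, 1 < l ∧ ∃ᶠ k : ℕ in atTop,
        θ * volume (heatShell X₀ (l ^ k) (l ^ (k + 1))) <
          volume (heatShell X₀ (l ^ k) (l ^ (k + 1)) \ Q)) → WienerRegular Q X₀) ∧
    ((∃ θ : ℝ≥0∞, θ ≠ 0 ∧ ∃ᶠ r in 𝓝[>] (0 : ℝ),
        θ * volume (parabolicCylinder X₀ r) < volume (parabolicCylinder X₀ r \ Q)) →
      WienerRegular Q X₀) :=
  ⟨fun ⟨_, hθ, _, hl, h⟩ => wienerRegular_of_frequently_lt_volume_heatShell_diff hn hQ hθ hl h,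
    fun ⟨_, hθ, h⟩ => wienerRegular_of_frequently_lt_volume_parabolicCylinder_diff hn hQ hθ h⟩

theorem theoremA7 (n : ℕ) (hn : 1 ≤ n) (Q : Set (ThermalWiener.SpaceTime n)) (hQ : IsOpen Q) :
    (ThermalWiener.ConditionB Q →
      ∀ X₀ ∈ ThermalWiener.parabolicBoundary Q, ThermalWiener.WienerRegular Q X₀) ∧
    (ThermalWiener.ConditionA Q →
      ∀ X₀ ∈ ThermalWiener.parabolicBoundary Q, ThermalWiener.WienerRegular Q X₀) := by
  have general := theoremA7_general (Nat.one_le_iff_ne_zero.1 hn) hQ.measurableSet.nullMeasurableSet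
  exact ⟨fun hB X₀ hX => (general X₀).1 (hB.exists_frequently hX),
    fun hA X₀ hX => (general X₀).2 (hA.exists_frequently hX)⟩
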